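/- Let $T=(t_s)_{s\in\mathbb{Z}}$ be i.i.d. random variables with uniform distribution on $[0,1]$, and let $\mathbb{P}$ be the corresponding product measure on $[0,1]^{\mathbb{Z}}$. In the random sequential adsorption process on $\mathbb{Z}$ with nearest-neighbour exclusion, all sites are initially vacant and each site $s$ becomes (and then stays) occupied at time $t_s$ if both $s-1$ and $s+1$ are vacant at that time. That is, the state $\omega_s(t)=\omega_s(T,t)\in\{0,1\}$ of the site $s$ at time $t$ is given by $$\omega_s(T,t)=1 \iff t_s\le t,\ \ \omega_{s-1}(T,t_s)=0\ \text{ and }\ \omega_{s+1}(T,t_s)=0 \qquad (s\in\mathbb{Z},\ t\in[0,1]).$$ For $\mathbb{P}$-almost every $T$ this recursion has exactly one solution $(\omega_s(T,t))_{s\in\mathbb{Z},\,t\in[0,1]}$. Moreover, for every $t\in[0,1]$ and every even integer $s\ge 0$, the event $\{\omega_{-1}(t)=\omega_0(t)=0,\ \omega_s(t)=1\}$ is measurable up to a $\mathbb{P}$-null set and $$\gamma_s(t):=\mathbb{P}\bigl(\omega_{-1}(t)=\omega_0(t)=0,\ \omega_s(t)=1\bigr)=-\tfrac12\, e^{-2t}\sum_{i=1}^{s}\frac{(-2t)^i}{i!}.$$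 -/

import Mathlib

open MeasureTheory

namespace RSA

/-- The evolution of a configuration: `ω t s` is the state of the site `s` at time `t`
(`1` is occupied, `0` is vacant). -/
abbrev Evolution : Type := unitInterval → ℤ → Fin 2

/-- `ω` is a random sequential adsorption process with nearest-neighbour exclusion on `ℤ`, driven
by the arrival times `T`: the state of `s` at time `t` is the product of the indicators of
`T s ≤ t`, of `s - 1` being vacant at time `T s`, and of `s + 1` being vacant at time `T s`. -/
def IsEvolution (T : ℤ → unitInterval) (ω : Evolution) : Prop :=
  ∀ t s, ω t s = 1 ↔ T s ≤ t ∧ ω (T s) (s - 1) = 0 ∧ ω (T s) (s + 1) = 0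

open Classical in
/-- The process `ω(T, ·)` driven by the arrival times `T`. For the exceptional `T` for which the
defining recursion does not have exactly one solution, all sites are declared vacant. -/
noncomputable def omega (T : ℤ → unitInterval) : Evolution :=
  if h : ∃! ω : Evolution, IsEvolution T ω then h.choose else fun _ _ => 0

/-- The law of a family, indexed by `ℤ`, of independent arrival times that are uniform
on `[0,1]`. -/
noncomputable def P : Measure (ℤ → unitInterval) :=
  Measure.infinitePi fun _ => (volume : Measure unitInterval)

/-- The event that at time `t` the sites `-1` and `0` are vacant and the site `s` is occupied. -/
def D (s : ℤ) (t : unitInterval) : Set (ℤ → unitInterval) :=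
  {T | omega T t (-1) = 0 ∧ omega T t 0 = 0 ∧ omega T t s = 1}

/-- The probability of the event `D s t`. -/
noncomputable def gamma (s : ℤ) (t : unitInterval) : ℝ := P.real (D s t)

end RSA

/-! Almost surely there are no ties, and from each site, in each direction, some later site arrives
no earlier than it. Whether `s` is blocked from one side is then settled by a finite descent of
arrival times: an earlier-arriving neighbour has not yet felt `s`, so its state depends only on the
sites beyond it. Hence the recursion has exactly one solution, and `s` is occupied at time `t` iff
`T s ≤ t` and `s` is `Free` on both sides.

While `-1` and `0` are both vacant, the two half-lines do not interact (`Regular.mem_D_iff`). So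
`gamma` is a product of a half-line end vacancy probability, `exp (-t)`, and the probability `g_n`
that on `[0, ∞)` the site `0` is vacant and `n` is occupied.

Let `f_n` be the probability that both ends of an interval of `n + 1` sites are vacant. Conditioning
on the first end to be occupied gives `f_{n+1}' = -2 f_n`. The site `n + 1` becomes occupied at rate
`f_n exp (-t)` while `0` is vacant, and `0` is then lost at rate `g_n`, so `g_{n+1}' = f_n exp (-t)
- g_n`. Both systems are solved by partial exponential sums at `-2 t`. -/

namespace RSA

open Filter Topology

/-! ### One-sided descents of arrival times -/

variable {T T' : ℤ → unitInterval} {d s : ℤ} {n : ℕ}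

/-- In the process restricted to the sites `s, s + d, …, s + n * d`, the site `s` finds its
neighbour `s + d` vacant at its arrival time. -/
def FreeUpTo (d : ℤ) : ℕ → (ℤ → unitInterval) → ℤ → Prop
  | 0, _, _ => True
  | n + 1, T, s => ¬ (T (s + d) < T s ∧ FreeUpTo d n T (s + d))

/-- In the process restricted to the half-line `s, s + d, s + 2 * d, …`, the site `s` finds its
neighbour `s + d` vacant at its arrival time. -/
def Free (d : ℤ) (T : ℤ → unitInterval) (s : ℤ) : Prop :=
  ∀ᶠ n in atTop, FreeUpTo d n T s

/-- Arrival times without ties and without infinite monotone descents. -/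
structure Regular (T : ℤ → unitInterval) : Prop where
  injective : Function.Injective T
  exists_le : ∀ d ≠ 0, ∀ s, ∃ n : ℕ, T s ≤ T (s + (n + 1) * d)

lemma freeUpTo_zero : FreeUpTo d 0 T s := trivial

lemma freeUpTo_succ :
    FreeUpTo d (n + 1) T s ↔ ¬ (T (s + d) < T s ∧ FreeUpTo d n T (s + d)) := Iff.rfl

lemma freeUpTo_of_le (h : T s ≤ T (s + d)) : FreeUpTo d n T s := by
  cases n with
  | zero => trivial
  | succ n => exact fun h' => absurd h'.1 h.not_gt

lemma freeUpTo_congr (h : ∀ i : ℕ, i ≤ n → T (s + i * d) = T' (s + i * d)) :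
    FreeUpTo d n T s ↔ FreeUpTo d n T' s := by
  induction n generalizing s with
  | zero => simp [FreeUpTo]
  | succ n ih =>
    have h0 := h 0 (by omega)
    have h1 := h 1 (by omega)
    have h2 := ih (s := s + d) fun i hi => by
      have := h (i + 1) (by omega)
      convert this using 2 <;> push_cast <;> ring
    simp only [Nat.cast_zero, zero_mul, add_zero, Nat.cast_one, one_mul] at h0 h1
    rw [freeUpTo_succ, freeUpTo_succ, h0, h1, h2]

lemma free_congr (h : ∀ i : ℕ, T (s + i * d) = T' (s + i * d)) : Free d T s ↔ Free d T' s := by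
  simp only [Free, freeUpTo_congr fun i _ => h i]

/-- A descent along `s, s + d, …` ends before it reaches a site that arrives after `s`. -/
lemma freeUpTo_iff_of_le (h : T s ≤ T (s + (n + 1) * d)) {m : ℕ} (hm : n ≤ m) :
    FreeUpTo d m T s ↔ FreeUpTo d n T s := by
  induction n generalizing s m with
  | zero =>
    have h' : T s ≤ T (s + d) := by simpa using h
    simp [freeUpTo_of_le h']
  | succ n ih =>
    obtain ⟨m, rfl⟩ := Nat.exists_eq_succ_of_ne_zero (by omega : m ≠ 0)
    rw [freeUpTo_succ, freeUpTo_succ]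
    by_cases h1 : T (s + d) < T s
    · rw [ih (s := s + d) _ (by omega)]
      refine h1.le.trans (h.trans_eq ?_)
      congr 1; push_cast; ring
    · simp [h1]

lemma free_iff_of_le (h : T s ≤ T (s + (n + 1) * d)) : Free d T s ↔ FreeUpTo d n T s := by
  have : ∀ᶠ m in atTop, (FreeUpTo d m T s ↔ FreeUpTo d n T s) :=
    (eventually_ge_atTop n).mono fun m hm => freeUpTo_iff_of_le h hm
  rw [Free, eventually_congr this, eventually_const]

lemma free_of_le (h : T s ≤ T (s + d)) : Free d T s :=
  Eventually.of_forall fun _ => freeUpTo_of_le h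

/-- The recursion for `FreeUpTo` passes to the limit because regularity makes both descents
stabilise after finitely many sites. -/
lemma Regular.free_iff (hT : Regular T) (hd : d ≠ 0) :
    Free d T s ↔ ¬ (T (s + d) < T s ∧ Free d T (s + d)) := by
  by_cases h : T (s + d) < T s
  · obtain ⟨n, hn⟩ := hT.exists_le d hd s
    cases n with
    | zero => exact absurd h (by simpa using hn)
    | succ n =>
      have hn' : T (s + d) ≤ T (s + d + (n + 1) * d) := by
        refine h.le.trans (hn.trans_eq ?_)
        congr 1; push_cast; ring
      rw [free_iff_of_le hn, free_iff_of_le hn', freeUpTo_succ]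
  · simp [h, free_of_le (not_lt.1 h)]

lemma Regular.lt_iff_le (hT : Regular T) {r s : ℤ} (h : r ≠ s) : T r < T s ↔ T r ≤ T s :=
  ⟨le_of_lt, fun h' => lt_of_le_of_ne h' fun e => h (hT.injective e)⟩

/-! ### Existence, uniqueness and description of the process -/

section Evolution

variable {ω : Evolution}

lemma IsEvolution.eq_one_iff (hω : IsEvolution T ω) (t : unitInterval) (s : ℤ) :
    ω t s = 1 ↔ T s ≤ t ∧ ω (T s) s = 1 := by
  rw [hω t s, hω (T s) s]
  simp

lemma fin_two_eq_zero_iff (a : Fin 2) : a = 0 ↔ ¬ a = 1 := by omega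

lemma IsEvolution.at_arrival (hω : IsEvolution T ω) (hd : d = 1 ∨ d = -1) (s : ℤ) :
    ω (T s) s = 1 ↔ ¬ (T (s + d) ≤ T s ∧ ω (T (s + d)) (s + d) = 1) ∧
      ¬ (T (s - d) ≤ T s ∧ ω (T (s - d)) (s - d) = 1) := by
  rw [hω (T s) s, fin_two_eq_zero_iff, fin_two_eq_zero_iff, hω.eq_one_iff, hω.eq_one_iff _ (s + 1)]
  rcases hd with rfl | rfl
  · simp only [le_refl, true_and]; tauto
  · simp only [le_refl, true_and, ← sub_eq_add_neg, sub_neg_eq_add]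

/-- The neighbour `s - d` arrives too late to block `s`, so only the side of `s + d` counts. If `s +
d` arrives before `s`, it is in the same situation, with a shorter descent left: hence induction on
the distance to a site arriving no earlier. -/
lemma IsEvolution.iff_free_of_lt (hω : IsEvolution T ω) (hT : Regular T)
    (hd : d = 1 ∨ d = -1) (hs : T s < T (s - d)) :
    ω (T s) s = 1 ↔ Free d T s := by
  have hd0 : d ≠ 0 := by omega
  obtain ⟨n, hn⟩ := hT.exists_le d hd0 s
  induction n generalizing s with
  | zero =>
    have h : T s ≤ T (s + d) := by simpa using hn
    rw [hω.at_arrival hd, ← hT.lt_iff_le (by omega), hT.free_iff hd0]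
    simp [hs.not_ge, h.not_gt]
  | succ n ih =>
    rw [hω.at_arrival hd, ← hT.lt_iff_le (by omega), hT.free_iff hd0]
    by_cases h : T (s + d) < T s
    · have hn' : T (s + d) ≤ T (s + d + (n + 1) * d) := by
        refine h.le.trans (hn.trans_eq ?_)
        congr 1; push_cast; ring
      have key : ω (T (s + d)) (s + d) = 1 ↔ Free d T (s + d) := ih (by simpa using h) hn'
      rw [key]
      simp [hs.not_ge]
    · simp [hs.not_ge, h]

lemma IsEvolution.iff_free (hω : IsEvolution T ω) (hT : Regular T) (t : unitInterval) (s : ℤ) :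
    ω t s = 1 ↔ T s ≤ t ∧ Free 1 T s ∧ Free (-1) T s := by
  rw [hω.eq_one_iff, hω.at_arrival (.inl rfl), ← hT.lt_iff_le (by omega),
    ← hT.lt_iff_le (by omega), hT.free_iff one_ne_zero, hT.free_iff (d := -1) (by omega),
    ← sub_eq_add_neg]
  have h1 : T (s + 1) < T s → (ω (T (s + 1)) (s + 1) = 1 ↔ Free 1 T (s + 1)) := fun h =>
    hω.iff_free_of_lt hT (.inl rfl) (by simpa using h)
  have h2 : T (s - 1) < T s → (ω (T (s - 1)) (s - 1) = 1 ↔ Free (-1) T (s - 1)) := fun h =>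
    hω.iff_free_of_lt hT (.inr rfl) (by simpa using h)
  tauto

open Classical in
-- A neighbour that arrives before `s` is automatically free on the side facing `s`, so its
-- two-sided condition reduces to the one-sided condition in `Regular.free_iff`.
lemma Regular.isEvolution (hT : Regular T) :
    IsEvolution T fun t s => if T s ≤ t ∧ Free 1 T s ∧ Free (-1) T s then 1 else 0 := by
  intro t s
  have e1 (p : Prop) [Decidable p] : (if p then (1 : Fin 2) else 0) = 1 ↔ p := by
    split_ifs <;> simp_all
  have e0 (p : Prop) [Decidable p] : (if p then (1 : Fin 2) else 0) = 0 ↔ ¬ p := by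
    split_ifs <;> simp_all
  simp only [e1, e0]
  rw [← hT.lt_iff_le (r := s - 1) (by omega), ← hT.lt_iff_le (r := s + 1) (by omega),
    hT.free_iff (s := s) one_ne_zero, hT.free_iff (d := -1) (s := s) (by omega),
    ← sub_eq_add_neg]
  have h1 : T (s + 1) < T s → Free (-1) T (s + 1) := fun h =>
    free_of_le (by simpa using h.le)
  have h2 : T (s - 1) < T s → Free 1 T (s - 1) := fun h =>
    free_of_le (by simpa using h.le)
  tauto

lemma Regular.existsUnique (hT : Regular T) : ∃! ω : Evolution, IsEvolution T ω := by
  refine ⟨_, hT.isEvolution, fun ω hω => ?_⟩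
  funext t s
  have h := (hω.iff_free hT t s).trans (hT.isEvolution.iff_free hT t s).symm
  omega

lemma Regular.omega_eq_one_iff (hT : Regular T) (t : unitInterval) (s : ℤ) :
    omega T t s = 1 ↔ T s ≤ t ∧ Free 1 T s ∧ Free (-1) T s := by
  have h : omega T = hT.existsUnique.choose := dif_pos hT.existsUnique
  rw [h]
  exact IsEvolution.iff_free hT.existsUnique.choose_spec.1 hT t s

end Evolution

/-- Below a site `s + n` that arrives by time `t`, the process on `[s, ∞)` agrees with the process
on `ℤ` as long as the sites `s - 1` and `s` are vacant. -/
lemma Regular.free_neg_iff_freeUpTo (hT : Regular T)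
    (h : T s < T (s - 1) ∨ ¬ Free (-1) T (s - 1)) :
    Free (-1) T (s + n) ↔ FreeUpTo (-1) n T (s + n) := by
  induction n with
  | zero =>
    rw [hT.free_iff (by omega)]
    have : T (s - 1) < T s → ¬ Free (-1) T (s - 1) := fun h' => h.resolve_left h'.not_gt
    simpa [freeUpTo_zero, ← sub_eq_add_neg] using this
  | succ n ih =>
    rw [hT.free_iff (by omega), freeUpTo_succ]
    have : s + ((n + 1 : ℕ) : ℤ) + -1 = s + n := by push_cast; ring
    rw [this, ih]
-- Decomposition of events on intervals and half-lines
/-- In the process on `{s, …, s + n}`, both end sites are vacant at time `t`. -/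
def endsVacant (n : ℕ) (s : ℤ) (t : unitInterval) : Set (ℤ → unitInterval) :=
  {T | ¬ (T s ≤ t ∧ FreeUpTo 1 n T s) ∧ ¬ (T (s + n) ≤ t ∧ FreeUpTo (-1) n T (s + n))}

/-- In the process on the half-line `s, s + d, …`, the site `s` is vacant at time `t`. -/
def endVacant (d s : ℤ) (t : unitInterval) : Set (ℤ → unitInterval) :=
  {T | ¬ (T s ≤ t ∧ Free d T s)}

/-- In the process on `[s, ∞)`, at time `t` the site `s` is vacant and `s + n` is occupied. -/
def endVacantOccupied (n : ℕ) (s : ℤ) (t : unitInterval) : Set (ℤ → unitInterval) :=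
  {T | T ∈ endVacant 1 s t ∧ T (s + n) ≤ t ∧ FreeUpTo (-1) n T (s + n) ∧ Free 1 T (s + n)}

lemma Regular.mem_D_iff (hT : Regular T) (n : ℕ) (t : unitInterval) :
    T ∈ D n t ↔ T ∈ endVacant (-1) (-1) t ∧ T ∈ endVacantOccupied n 0 t := by
  simp only [D, endVacant, endVacantOccupied, Set.mem_ofPred_eq, fin_two_eq_zero_iff,
    hT.omega_eq_one_iff, zero_add]
  have h1 : T (-1) ≤ T 0 → Free 1 T (-1) := fun h => free_of_le (by simpa using h)
  have h2 : T 0 ≤ T (-1) → Free (-1) T 0 := fun h => free_of_le (by simpa using h)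
  have h3 : Free 1 T (-1) ↔ ¬ (T 0 < T (-1) ∧ Free 1 T 0) := by
    simpa using hT.free_iff (d := 1) (s := -1) one_ne_zero
  have h4 : Free (-1) T 0 ↔ ¬ (T (-1) < T 0 ∧ Free (-1) T (-1)) := by
    simpa using hT.free_iff (d := -1) (s := 0) (by omega)
  -- If `n` arrives before `-1`, its leftward descent stops before passing `0`. Otherwise `-1` has
  -- arrived by time `t`, and being vacant it must be blocked from the left, so `h6` applies.
  have h5 : T n ≤ T (-1) → (Free (-1) T n ↔ FreeUpTo (-1) n T n) := fun h =>
    free_iff_of_le (by simpa using h)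
  have h6 : ¬ Free (-1) T (-1) → (Free (-1) T n ↔ FreeUpTo (-1) n T n) := fun h => by
    simpa using hT.free_neg_iff_freeUpTo (s := 0) (n := n) (.inr (by simpa using h))
  have h7 : T (-1) ≤ T 0 ∨ T 0 < T (-1) := le_or_gt _ _
  grind

/-- The free predicates at the two ends of `{s, …, s + n + 1}`, in terms of shorter intervals. -/
lemma Regular.ends_facts (hT : Regular T) (n : ℕ) (s : ℤ) :
    T s ≠ T (s + n + 1) ∧
    (FreeUpTo 1 (n + 1) T s ↔ ¬ (T (s + 1) ≤ T s ∧ FreeUpTo 1 n T (s + 1))) ∧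
    (FreeUpTo (-1) (n + 1) T (s + n + 1) ↔
      ¬ (T (s + n) ≤ T (s + n + 1) ∧ FreeUpTo (-1) n T (s + n))) ∧
    (T s ≤ T (s + n + 1) → (FreeUpTo 1 (n + 1) T s ↔ FreeUpTo 1 n T s)) ∧
    (T (s + n + 1) ≤ T s → (FreeUpTo (-1) (n + 1) T (s + n + 1) ↔
      FreeUpTo (-1) n T (s + n + 1))) := by
  refine ⟨fun h => ?_, ?_, ?_, fun h => ?_, fun h => ?_⟩
  · have := hT.injective h; omega
  · rw [freeUpTo_succ, hT.lt_iff_le (by omega)]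
  · rw [freeUpTo_succ, hT.lt_iff_le (by omega), ← sub_eq_add_neg, add_sub_cancel_right]
  · refine freeUpTo_iff_of_le (h.trans_eq ?_) n.le_succ
    congr 1; ring
  · refine freeUpTo_iff_of_le (h.trans_eq ?_) n.le_succ
    congr 1; ring

/-- Split according to which end is occupied first. At the arrival of that end, its neighbour and
the opposite end are vacant in the interval with the arriving end removed. -/
lemma Regular.notMem_endsVacant_succ_iff (hT : Regular T) (n : ℕ) (s : ℤ) (t : unitInterval) :
    T ∉ endsVacant (n + 1) s t ↔ (T s ≤ t ∧ T ∈ endsVacant n (s + 1) (T s)) ∨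
      (T (s + n + 1) ≤ t ∧ T ∈ endsVacant n s (T (s + n + 1))) := by
  obtain ⟨h1, h2, h3, h4, h5⟩ := hT.ends_facts n s
  simp only [endsVacant, Set.mem_ofPred_eq, Nat.cast_succ, ← add_assoc,
    add_right_comm s 1 (n : ℤ)]
  generalize T s = a, T (s + n + 1) = b at *
  grind

lemma Regular.endsVacant_disjoint (hT : Regular T) (n : ℕ) (s : ℤ) (t : unitInterval) :
    ¬ ((T s ≤ t ∧ T ∈ endsVacant n (s + 1) (T s)) ∧
      (T (s + n + 1) ≤ t ∧ T ∈ endsVacant n s (T (s + n + 1)))) := by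
  obtain ⟨h1, h2, h3, h4, h5⟩ := hT.ends_facts n s
  simp only [endsVacant, Set.mem_ofPred_eq, add_right_comm s 1 (n : ℤ)]
  generalize T s = a, T (s + n + 1) = b at *
  grind

/-- First `s + n + 1` must become occupied while `s` is vacant; the removed event is that `s`
becomes occupied later. `Regular.of_mem_endVacantOccupied` shows that the removed event lies inside
the first, so probabilities subtract. -/
lemma Regular.mem_endVacantOccupied_succ_iff (hT : Regular T) (n : ℕ) (s : ℤ) (t : unitInterval) :
    T ∈ endVacantOccupied (n + 1) s t ↔
      (T (s + n + 1) ≤ t ∧ T ∈ endsVacant n s (T (s + n + 1)) ∩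
        endVacant 1 (s + n + 2) (T (s + n + 1))) ∧
      ¬ (T s ≤ t ∧ T ∈ endVacantOccupied n (s + 1) (T s)) := by
  obtain ⟨h1, h2, h3, h4, h5⟩ := hT.ends_facts n s
  have h6 := hT.free_iff (d := 1) (s := s) one_ne_zero
  have h7 := hT.free_iff (d := 1) (s := s + n + 1) one_ne_zero
  rw [hT.lt_iff_le (by omega)] at h6 h7
  have h8 : T s ≤ T (s + n + 1) → (Free 1 T s ↔ FreeUpTo 1 n T s) := fun h =>
    free_iff_of_le (h.trans_eq (by congr 1; ring))
  have e : s + n + 1 + 1 = s + n + 2 := by ring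
  rw [e] at h7
  simp only [endsVacant, endVacant, endVacantOccupied, Set.mem_ofPred_eq, Set.mem_inter_iff,
    Nat.cast_succ, ← add_assoc, add_right_comm s 1 (n : ℤ)]
  generalize T s = a, T (s + n + 1) = b at *
  grind

lemma Regular.of_mem_endVacantOccupied (hT : Regular T) (n : ℕ) (s : ℤ) (t : unitInterval)
    (h : T s ≤ t ∧ T ∈ endVacantOccupied n (s + 1) (T s)) :
    T (s + n + 1) ≤ t ∧ T ∈ endsVacant n s (T (s + n + 1)) ∩
        endVacant 1 (s + n + 2) (T (s + n + 1)) := by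
  obtain ⟨h1, h2, h3, h4, h5⟩ := hT.ends_facts n s
  have h7 := hT.free_iff (d := 1) (s := s + n + 1) one_ne_zero
  rw [hT.lt_iff_le (by omega)] at h7
  have e : s + n + 1 + 1 = s + n + 2 := by ring
  rw [e] at h7
  simp only [endsVacant, endVacant, endVacantOccupied, Set.mem_ofPred_eq, Set.mem_inter_iff,
    add_right_comm s 1 (n : ℤ)] at h ⊢
  generalize T s = a, T (s + n + 1) = b at *
  grind

instance : IsProbabilityMeasure P := by unfold P; infer_instance

lemma Regular.eventually_freeUpTo_iff (hT : Regular T) (hd : d ≠ 0) (s : ℤ) :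
    ∀ᶠ n in atTop, (FreeUpTo d n T s ↔ Free d T s) := by
  obtain ⟨n, hn⟩ := hT.exists_le d hd s
  filter_upwards [eventually_ge_atTop n] with m hm
  rw [free_iff_of_le hn, freeUpTo_iff_of_le hn hm]

/-! ### Measurability, jointly in time and arrival times -/

section Measurability

lemma measurableSet_freeUpTo (d : ℤ) (n : ℕ) (s : ℤ) :
    MeasurableSet {T : ℤ → unitInterval | FreeUpTo d n T s} := by
  induction n generalizing s with
  | zero => exact MeasurableSet.const True
  | succ n ih =>
    exact ((measurableSet_lt (f := fun T : ℤ → unitInterval => T (s + d)) (g := fun T => T s)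
      (by fun_prop) (by fun_prop)).inter (ih (s + d))).compl

lemma measurableSet_free (d s : ℤ) : MeasurableSet {T : ℤ → unitInterval | Free d T s} := by
  simp only [Free, eventually_atTop, Set.ofPred_exists, Set.ofPred_forall]
  exact .iUnion fun a => .iInter fun n => .iInter fun _ => measurableSet_freeUpTo d n s

lemma measurableSet_apply_le (s : ℤ) :
    MeasurableSet {p : unitInterval × (ℤ → unitInterval) | p.2 s ≤ p.1} :=
  measurableSet_le ((measurable_pi_apply s).comp measurable_snd) measurable_fst

lemma measurableSet_endsVacant (n : ℕ) (s : ℤ) :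
    MeasurableSet {p : unitInterval × (ℤ → unitInterval) | p.2 ∈ endsVacant n s p.1} :=
  ((measurableSet_apply_le _).inter (measurable_snd (measurableSet_freeUpTo 1 n s))).compl.inter
    ((measurableSet_apply_le _).inter
      (measurable_snd (measurableSet_freeUpTo (-1) n (s + n)))).compl

lemma measurableSet_endVacant (d s : ℤ) :
    MeasurableSet {p : unitInterval × (ℤ → unitInterval) | p.2 ∈ endVacant d s p.1} :=
  ((measurableSet_apply_le _).inter (measurable_snd (measurableSet_free d s))).compl

lemma measurableSet_endVacantOccupied (n : ℕ) (s : ℤ) :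
    MeasurableSet {p : unitInterval × (ℤ → unitInterval) | p.2 ∈ endVacantOccupied n s p.1} :=
  (measurableSet_endVacant 1 s).inter ((measurableSet_apply_le _).inter
    ((measurable_snd (measurableSet_freeUpTo (-1) n (s + n))).inter
      (measurable_snd (measurableSet_free 1 (s + n)))))

lemma measurableSet_section {E : unitInterval → Set (ℤ → unitInterval)}
    (hE : MeasurableSet {p : unitInterval × (ℤ → unitInterval) | p.2 ∈ E p.1}) (t : unitInterval) :
    MeasurableSet (E t) :=
  measurable_prodMk_left (x := t) hE

lemma measurableSet_arrival {E : unitInterval → Set (ℤ → unitInterval)}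
    (hE : MeasurableSet {p : unitInterval × (ℤ → unitInterval) | p.2 ∈ E p.1})
    (r : ℤ) (t : unitInterval) :
    MeasurableSet {T : ℤ → unitInterval | T r ≤ t ∧ T ∈ E (T r)} :=
  (measurableSet_le (measurable_pi_apply r) measurable_const).inter
    ((show Measurable fun T : ℤ → unitInterval => (T r, T) by fun_prop) hE)

end Measurability

/-! ### Independence and conditioning on one arrival time -/

section Independence

open Classical in
/-- The arrival times that agree with `p.1` on `S` and with `p.2` outside of `S`. -/
noncomputable def glue (S : Set ℤ) (p : (ℤ → unitInterval) × (ℤ → unitInterval)) :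
    ℤ → unitInterval :=
  fun i => if i ∈ S then p.1 i else p.2 i

lemma glue_of_mem {S : Set ℤ} {i : ℤ} (h : i ∈ S) (p : (ℤ → unitInterval) × (ℤ → unitInterval)) :
    glue S p i = p.1 i := if_pos h

lemma glue_of_notMem {S : Set ℤ} {i : ℤ} (h : i ∉ S)
    (p : (ℤ → unitInterval) × (ℤ → unitInterval)) : glue S p i = p.2 i := if_neg h

lemma measurable_glue (S : Set ℤ) : Measurable (glue S) := by
  refine measurable_pi_lambda _ fun i => ?_
  unfold glue
  split_ifs <;> fun_prop

/-- Replacing the coordinates outside `S` by an independent copy preserves the law; independence and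
conditioning both follow from this. -/
lemma map_glue (S : Set ℤ) : (P.prod P).map (glue S) = P := by
  classical
  refine Measure.eq_infinitePi _ fun F B hB => ?_
  rw [Measure.map_apply (measurable_glue S) (.pi F.countable_toSet fun _ _ => hB _)]
  have : glue S ⁻¹' (Set.pi F B) =
      (Set.pi (F.filter (· ∈ S)) B) ×ˢ (Set.pi (F.filter (· ∉ S)) B) := by
    ext p
    simp only [Set.mem_preimage, Set.mem_pi, Set.mem_prod, Finset.mem_coe, Finset.mem_filter]
    constructor
    · intro h
      exact ⟨fun i hi => glue_of_mem hi.2 p ▸ h i hi.1,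
        fun i hi => glue_of_notMem hi.2 p ▸ h i hi.1⟩
    · intro h i hi
      by_cases hS : i ∈ S
      · exact (glue_of_mem hS p).symm ▸ h.1 i ⟨hi, hS⟩
      · exact (glue_of_notMem hS p).symm ▸ h.2 i ⟨hi, hS⟩
  rw [this, Measure.prod_prod, P, Measure.infinitePi_pi _ fun i _ => hB i,
    Measure.infinitePi_pi _ fun i _ => hB i, Finset.prod_filter_mul_prod_filter_not]

/-- Events that depend on disjoint sets of sites are independent. -/
lemma real_inter_of_dependsOn {A B : Set (ℤ → unitInterval)} (S : Set ℤ)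
    (hA : MeasurableSet A) (hB : MeasurableSet B)
    (hAS : ∀ T T' : ℤ → unitInterval, (∀ i ∈ S, T i = T' i) → (T ∈ A ↔ T' ∈ A))
    (hBS : ∀ T T' : ℤ → unitInterval, (∀ i ∉ S, T i = T' i) → (T ∈ B ↔ T' ∈ B)) :
    P.real (A ∩ B) = P.real A * P.real B := by
  have h : P (A ∩ B) = P A * P B := by
    conv_lhs => rw [← map_glue S]
    rw [Measure.map_apply (measurable_glue S) (hA.inter hB), ← Measure.prod_prod]
    congr 1
    ext p
    simp only [Set.mem_preimage, Set.mem_inter_iff, Set.mem_prod]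
    rw [hAS _ p.1 fun i hi => glue_of_mem hi p, hBS _ p.2 fun i hi => glue_of_notMem hi p]
  simp [measureReal_def, h]

/-- Conditioning on the arrival time of the site `r`. -/
lemma measure_arrival {E : unitInterval → Set (ℤ → unitInterval)}
    (hE : MeasurableSet {p : unitInterval × (ℤ → unitInterval) | p.2 ∈ E p.1}) (r : ℤ)
    (hr : ∀ u, ∀ T T' : ℤ → unitInterval, (∀ i ≠ r, T i = T' i) → (T ∈ E u ↔ T' ∈ E u))
    (t : unitInterval) :
    P {T | T r ≤ t ∧ T ∈ E (T r)} = ∫⁻ u in Set.Iic t, P (E u) := by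
  have hA := measurableSet_arrival hE r t
  have hm := measurable_glue {r}
  conv_lhs => rw [← map_glue {r}]
  rw [Measure.map_apply hm hA, Measure.prod_apply (hm hA)]
  have key : ∀ T : ℤ → unitInterval, P (Prod.mk T ⁻¹'
      (glue {r} ⁻¹' {T | T r ≤ t ∧ T ∈ E (T r)})) =
      (Set.Iic t).indicator (fun u => P (E u)) (T r) := by
    intro T
    by_cases h : T r ≤ t
    · rw [Set.indicator_of_mem (by exact h)]
      congr 1
      ext T'
      simp only [Set.mem_preimage, Set.mem_ofPred_eq, glue_of_mem (Set.mem_singleton r), h,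
        true_and]
      exact hr _ _ _ fun i hi => glue_of_notMem (S := {r}) (by simpa using hi) _
    · rw [Set.indicator_of_notMem (by exact h)]
      convert measure_empty (μ := P)
      ext T'
      simp [glue_of_mem (Set.mem_singleton r), h]
  rw [lintegral_congr key]
  rw [← lintegral_indicator measurableSet_Iic]
  exact (measurePreserving_eval_infinitePi (fun _ : ℤ => (volume : Measure unitInterval))
    r).lintegral_comp ((measurable_measure_prodMk_left hE).indicator measurableSet_Iic)

lemma real_arrival {E : unitInterval → Set (ℤ → unitInterval)}
    (hE : MeasurableSet {p : unitInterval × (ℤ → unitInterval) | p.2 ∈ E p.1}) (r : ℤ)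
    (hr : ∀ u, ∀ T T' : ℤ → unitInterval, (∀ i ≠ r, T i = T' i) → (T ∈ E u ↔ T' ∈ E u))
    (t : unitInterval) :
    P.real {T | T r ≤ t ∧ T ∈ E (T r)} = ∫ u in Set.Iic t, P.real (E u) := by
  have hm : Measurable fun u => P (E u) := measurable_measure_prodMk_left hE
  simp_rw [measureReal_def]
  rw [integral_toReal hm.aemeasurable (Eventually.of_forall fun u => measure_lt_top _ _),
    measure_arrival hE r hr]

end Independence

/-! ### Almost every family of arrival times is regular -/

section Regularity

lemma ae_ne {i j : ℤ} (h : i ≠ j) : ∀ᵐ T ∂P, T i ≠ T j := by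
  have hE : MeasurableSet {p : unitInterval × (ℤ → unitInterval) |
      p.2 ∈ {T : ℤ → unitInterval | T j = p.1}} :=
    measurableSet_eq_fun ((measurable_pi_apply j).comp measurable_snd) measurable_fst
  -- The final argument `1` makes the constraint `T i ≤ 1` vacuous.
  have h1 := measure_arrival (E := fun u => {T | T j = u}) hE i (fun u T T' hT => by simp [hT j h.symm]) 1
  have h2 : ∀ u : unitInterval, P {T | T j = u} = 0 := fun u => by
    have := (measurePreserving_eval_infinitePi (fun _ : ℤ => (volume : Measure unitInterval))
      j).measure_preimage (s := {u}) (measurableSet_singleton u).nullMeasurableSet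
    rw [measure_singleton] at this
    exact this
  simp only [h2, lintegral_zero] at h1
  rw [ae_iff]
  convert h1 using 2
  ext T
  simp [unitInterval.le_one', eq_comm]

/-- The first `N` of these independent constraints already have probability `u ^ N`, which tends to
`0`. -/
lemma measure_forall_lt_eq_zero {d : ℤ} (hd : d ≠ 0) (s : ℤ) {u : unitInterval} (hu : u < 1) :
    P {T | ∀ n : ℕ, T (s + (n + 1) * d) < u} = 0 := by
  have hu' : (u : ℝ) < 1 := hu
  have h : ∀ N : ℕ, P {T | ∀ n : ℕ, T (s + (n + 1) * d) < u} ≤ ENNReal.ofReal u ^ N := by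
    intro N
    have hinj : Function.Injective fun n : ℕ => s + (n + 1) * d := by
      intro a b hab
      simpa [hd] using hab
    let F := (Finset.range N).image fun n : ℕ => s + (n + 1) * d
    calc _ ≤ P (Set.pi F fun _ => Set.Iio u) := by
          refine measure_mono fun T hT i hi => ?_
          obtain ⟨n, -, rfl⟩ := Finset.mem_image.1 hi
          exact hT n
      _ = _ := by
          rw [P, Measure.infinitePi_pi _ fun i _ => measurableSet_Iio]
          simp [F, Finset.card_image_of_injective _ hinj]
  refine le_antisymm (ge_of_tendsto' (ENNReal.tendsto_pow_atTop_nhds_zero_of_lt_one ?_) h) zero_le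
  rw [ENNReal.ofReal_lt_one]
  exact hu'

lemma ae_exists_le {d : ℤ} (hd : d ≠ 0) (s : ℤ) :
    ∀ᵐ T ∂P, ∃ n : ℕ, T s ≤ T (s + (n + 1) * d) := by
  have hE : MeasurableSet {p : unitInterval × (ℤ → unitInterval) |
      p.2 ∈ {T : ℤ → unitInterval | ∀ n : ℕ, T (s + (n + 1) * d) < p.1}} := by
    have h : {p : unitInterval × (ℤ → unitInterval) |
        p.2 ∈ {T : ℤ → unitInterval | ∀ n : ℕ, T (s + (n + 1) * d) < p.1}} =
        ⋂ n : ℕ, {p | p.2 (s + (n + 1) * d) < p.1} := by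
      ext p; simp
    rw [h]
    exact .iInter fun n => measurableSet_lt
      ((measurable_pi_apply (s + (n + 1) * d)).comp measurable_snd) measurable_fst
  have h1 := measure_arrival (E := fun u => {T | ∀ n : ℕ, T (s + (n + 1) * d) < u}) hE s (fun u T T' hT => by
    have h : ∀ n : ℕ, T (s + (n + 1) * d) = T' (s + (n + 1) * d) := fun n => by
      refine hT _ ?_
      have : (n : ℤ) + 1 ≠ 0 := by omega
      simp [hd, this]
    simp only [Set.mem_ofPred_eq, h]) 1
  have h2 : ∀ᵐ u : unitInterval ∂volume.restrict (Set.Iic 1),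
      P {T | ∀ n : ℕ, T (s + (n + 1) * d) < u} = 0 := by
    refine ae_restrict_of_ae ?_
    filter_upwards [compl_mem_ae_iff.2 (measure_singleton (1 : unitInterval))] with u hu
    exact measure_forall_lt_eq_zero hd s (lt_of_le_of_ne unitInterval.le_one' hu)
  rw [lintegral_congr_ae h2, lintegral_zero] at h1
  rw [ae_iff]
  convert h1 using 2
  ext T
  simp [unitInterval.le_one']

lemma ae_regular : ∀ᵐ T ∂P, Regular T := by
  have h1 : ∀ᵐ T ∂P, ∀ i j : ℤ, i ≠ j → T i ≠ T j := by
    simp only [ae_all_iff]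
    exact fun i j h => ae_ne h
  have h2 : ∀ᵐ T ∂P, ∀ d : ℤ, d ≠ 0 → ∀ s, ∃ n : ℕ, T s ≤ T (s + (n + 1) * d) := by
    simp only [ae_all_iff]
    exact fun d hd s => ae_exists_le hd s
  filter_upwards [h1, h2] with T h1 h2
  exact ⟨fun i j h => by_contra fun hij => h1 i j hij h, h2⟩

end Regularity

/-! ### Sites on which the events depend -/

section Locality

lemma endsVacant_congr {t : unitInterval} (h : ∀ i, s ≤ i → i ≤ s + n → T i = T' i) :
    T ∈ endsVacant n s t ↔ T' ∈ endsVacant n s t := by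
  simp only [endsVacant, Set.mem_ofPred_eq]
  rw [h s (by omega) (by omega), h (s + n) (by omega) (by omega),
    freeUpTo_congr fun i hi => h (s + i * 1) (by omega) (by omega),
    freeUpTo_congr fun i hi => h (s + n + i * -1) (by omega) (by omega)]

lemma endVacant_congr {t : unitInterval} (h : ∀ i : ℕ, T (s + i * d) = T' (s + i * d)) :
    T ∈ endVacant d s t ↔ T' ∈ endVacant d s t := by
  have h0 : T s = T' s := by simpa using h 0
  simp only [endVacant, Set.mem_ofPred_eq]
  rw [free_congr h, h0]

lemma endVacantOccupied_congr {t : unitInterval} (h : ∀ i, s ≤ i → T i = T' i) :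
    T ∈ endVacantOccupied n s t ↔ T' ∈ endVacantOccupied n s t := by
  simp only [endVacantOccupied, Set.mem_ofPred_eq]
  rw [endVacant_congr fun i => h (s + i * 1) (by omega), h (s + n) (by omega),
    freeUpTo_congr fun i hi => h (s + n + i * -1) (by omega),
    free_congr fun i => h (s + n + i * 1) (by omega)]

end Locality

/-! ### Integration over arrival times and partial exponential sums -/

section Calculus

lemma setIntegral_Iic_of_hasDerivAt {F f : ℝ → ℝ} (hF : ∀ x, HasDerivAt F (f x) x)
    (hf : Continuous f) (t : unitInterval) :
    ∫ u : unitInterval in Set.Iic t, f u = F t - F 0 := by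
  have h := unitInterval.measurePreserving_coe.setIntegral_preimage_emb
    unitInterval.measurableEmbedding_coe f (Set.Iic (t : ℝ))
  have h1 : ((↑) : unitInterval → ℝ) ⁻¹' Set.Iic (t : ℝ) = Set.Iic t := by ext; simp
  have h2 : Set.Iic (t : ℝ) ∩ unitInterval = Set.Icc 0 (t : ℝ) := by
    ext x
    simp only [Set.mem_inter_iff, Set.mem_Iic, Set.mem_Icc]
    exact ⟨fun h => ⟨h.2.1, h.1⟩, fun h => ⟨h.2, h.1, h.2.trans t.2.2⟩⟩
  rw [h1, Measure.restrict_restrict measurableSet_Iic, h2, integral_Icc_eq_integral_Ioc,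
    ← intervalIntegral.integral_of_le t.2.1] at h
  rw [h]
  exact intervalIntegral.integral_eq_sub_of_hasDerivAt (fun x _ => hF x)
    (hf.intervalIntegrable _ _)

/-- The partial sums of the exponential series. -/
noncomputable def expSum (n : ℕ) (x : ℝ) : ℝ :=
  ∑ i ∈ Finset.range n, x ^ i / (Nat.factorial i : ℝ)

lemma expSum_succ_zero (n : ℕ) : expSum (n + 1) 0 = 1 := by
  simp [expSum, Finset.sum_range_succ']

lemma expSum_one (x : ℝ) : expSum 1 x = 1 := by simp [expSum]

lemma expSum_two (x : ℝ) : expSum 2 x = 1 + x := by simp [expSum, Finset.sum_range_succ]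

@[fun_prop]
lemma continuous_expSum (n : ℕ) : Continuous (expSum n) := by
  unfold expSum; fun_prop

lemma hasDerivAt_expSum_succ (n : ℕ) (x : ℝ) :
    HasDerivAt (expSum (n + 1)) (expSum n x) x := by
  induction n with
  | zero =>
    have : expSum (0 + 1) = fun _ => 1 := funext expSum_one
    rw [this]
    simpa [expSum] using hasDerivAt_const x (1 : ℝ)
  | succ n ih =>
    have h1 : expSum (n + 1 + 1) = fun y =>
        expSum (n + 1) y + y ^ (n + 1) / (Nat.factorial (n + 1) : ℝ) :=
      funext fun y => Finset.sum_range_succ _ _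
    have h2 : expSum (n + 1) x = expSum n x + x ^ n / (Nat.factorial n : ℝ) :=
      Finset.sum_range_succ _ _
    rw [h1, h2]
    refine ih.add (((hasDerivAt_pow (n + 1) x).div_const _).congr_deriv ?_)
    rw [Nat.factorial_succ]
    push_cast
    field_simp

lemma hasDerivAt_expSum_succ_mul (n : ℕ) (c x : ℝ) :
    HasDerivAt (fun y => expSum (n + 1) (c * y)) (c * expSum n (c * x)) x := by
  exact (HasDerivAt.comp (h₂ := expSum (n + 1)) (h := fun y => c * y) x
    (hasDerivAt_expSum_succ n (c * x)) ((hasDerivAt_id x).const_mul c)).congr_deriv (by ring)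

lemma tendsto_expSum (x : ℝ) : Tendsto (fun n => expSum n x) atTop (𝓝 (Real.exp x)) := by
  have := NormedSpace.expSeries_div_hasSum_exp x
  rw [← Real.exp_eq_exp_ℝ] at this
  exact this.tendsto_sum_nat

end Calculus

/-! ### Differential recursions for the probabilities -/

section Probabilities

lemma real_apply_le (s : ℤ) (t : unitInterval) : P.real {T | T s ≤ t} = t := by
  have h := (measurePreserving_eval_infinitePi (fun _ : ℤ => (volume : Measure unitInterval))
    s).measure_preimage (s := Set.Iic t) measurableSet_Iic.nullMeasurableSet
  rw [unitInterval.volume_Iic] at h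
  rw [measureReal_def]
  refine (congrArg ENNReal.toReal h).trans (ENNReal.toReal_ofReal t.2.1)

lemma measurableSet_apply_le_freeUpTo (d : ℤ) (n : ℕ) (s : ℤ) :
    MeasurableSet {p : unitInterval × (ℤ → unitInterval) |
      p.2 ∈ {T : ℤ → unitInterval | ¬ (T s ≤ p.1 ∧ FreeUpTo d n T s)}} :=
  ((measurableSet_apply_le _).inter (measurable_snd (measurableSet_freeUpTo d n s))).compl

/-- Given that `s` arrives at time `u`, it is occupied iff `s + d` is vacant at `u` in the process
without `s`. The vacancy probabilities thus satisfy `p_{n+1}' = -p_n` with value `1` at time `0`. -/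
lemma real_not_freeUpTo (hd : d = 1 ∨ d = -1) (n : ℕ) (s : ℤ) (t : unitInterval) :
    P.real {T | ¬ (T s ≤ t ∧ FreeUpTo d n T s)} = expSum (n + 2) (-1 * t) := by
  have compl (n : ℕ) (s : ℤ) (t : unitInterval) :
      P.real {T | ¬ (T s ≤ t ∧ FreeUpTo d n T s)} =
        1 - P.real {T | T s ≤ t ∧ FreeUpTo d n T s} := by
    rw [← probReal_compl_eq_one_sub]
    · rfl
    · exact (measurableSet_le (measurable_pi_apply s) measurable_const).inter
        (measurableSet_freeUpTo d n s)
  induction n generalizing s t with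
  | zero =>
    rw [compl, expSum_two]
    simp only [freeUpTo_zero, and_true, real_apply_le]
    ring
  | succ n ih =>
    have h1 : P.real {T | T s ≤ t ∧ FreeUpTo d (n + 1) T s} =
        P.real {T | T s ≤ t ∧
          T ∈ {T' : ℤ → unitInterval | ¬ (T' (s + d) ≤ T s ∧ FreeUpTo d n T' (s + d))}} := by
      refine measureReal_congr ?_
      filter_upwards [ae_regular] with T hT
      refine propext (and_congr_right fun _ => ?_)
      rw [freeUpTo_succ, hT.lt_iff_le (by omega)]
    rw [compl, h1, real_arrival
      (E := fun u => {T' : ℤ → unitInterval | ¬ (T' (s + d) ≤ u ∧ FreeUpTo d n T' (s + d))})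
      (measurableSet_apply_le_freeUpTo d n (s + d)) s]
    · simp_rw [ih]
      rw [setIntegral_Iic_of_hasDerivAt (F := fun x => -expSum (n + 3) (-1 * x))
        (f := fun x => expSum (n + 2) (-1 * x))
        (fun x => ((hasDerivAt_expSum_succ_mul (n + 2) (-1) x).neg).congr_deriv (by ring))
        (by fun_prop)]
      simp [expSum_succ_zero]
    · intro u T T' h
      have h' : ∀ i : ℕ, T (s + d + i * d) = T' (s + d + i * d) := fun i => h _ (by
        rcases hd with rfl | rfl <;> omega)
      simp only [Set.mem_ofPred_eq]
      rw [freeUpTo_congr fun i _ => h' i, h (s + d) (by omega)]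

/-- Limit of the finite-interval probabilities: almost surely the interval and half-line events
agree once the interval is long enough. -/
lemma real_endVacant (hd : d = 1 ∨ d = -1) (s : ℤ) (t : unitInterval) :
    P.real (endVacant d s t) = Real.exp (-t) := by
  have h1 : Tendsto (fun n => P.real {T | ¬ (T s ≤ t ∧ FreeUpTo d n T s)}) atTop
      (𝓝 (P.real (endVacant d s t))) := by
    refine (ENNReal.tendsto_toReal (measure_ne_top _ _)).comp
      (tendsto_measure_of_ae_tendsto_indicator_of_isFiniteMeasure atTop
        (measurableSet_section (measurableSet_endVacant d s) t)
        (fun n => measurableSet_section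
          (E := fun u => {T : ℤ → unitInterval | ¬ (T s ≤ u ∧ FreeUpTo d n T s)})
          (measurableSet_apply_le_freeUpTo d n s) t) ?_)
    filter_upwards [ae_regular] with T hT
    filter_upwards [hT.eventually_freeUpTo_iff (d := d) (by omega) s] with n hn
    simp only [endVacant, Set.mem_ofPred_eq, hn]
  have h2 : Tendsto (fun n => expSum (n + 2) (-1 * t)) atTop (𝓝 (Real.exp (-1 * t))) :=
    (tendsto_expSum _).comp (tendsto_add_atTop_nat 2)
  simp_rw [real_not_freeUpTo hd] at h1
  rw [tendsto_nhds_unique h1 h2, neg_one_mul]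

/-- The probability that both ends of an interval of `n + 1` sites are vacant at time `x`. -/
noncomputable def endsVacantProb (n : ℕ) (x : ℝ) : ℝ :=
  (expSum (n + 1) (-2 * x) + expSum (n + 2) (-2 * x)) / 2

@[fun_prop]
lemma continuous_endsVacantProb (n : ℕ) : Continuous (endsVacantProb n) := by
  unfold endsVacantProb; fun_prop

lemma hasDerivAt_endsVacantProb_succ (n : ℕ) (x : ℝ) :
    HasDerivAt (endsVacantProb (n + 1)) (-2 * endsVacantProb n x) x := by
  refine (((hasDerivAt_expSum_succ_mul (n + 1) (-2) x).add
    (hasDerivAt_expSum_succ_mul (n + 2) (-2) x)).div_const 2).congr_deriv ?_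
  unfold endsVacantProb
  ring

lemma endsVacantProb_zero (n : ℕ) : endsVacantProb n 0 = 1 := by
  simp [endsVacantProb, expSum_succ_zero]

/-- By symmetry, either end being first contributes the integral of `f_n`, so `1 - f_{n+1} = 2 ∫
f_n`. -/
lemma real_endsVacant (n : ℕ) (s : ℤ) (t : unitInterval) :
    P.real (endsVacant n s t) = endsVacantProb n t := by
  induction n generalizing s t with
  | zero =>
    have h : endsVacant 0 s t = {T | T s ≤ t}ᶜ := by
      ext T; simp [endsVacant, freeUpTo_zero]
    rw [h, probReal_compl_eq_one_sub
      (measurableSet_le (measurable_pi_apply s) measurable_const), real_apply_le]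
    simp only [endsVacantProb, zero_add, expSum_one, expSum_two]
    ring
  | succ n ih =>
    have hA := measurableSet_arrival (measurableSet_endsVacant n (s + 1)) s t
    have hB := measurableSet_arrival (measurableSet_endsVacant n s) (s + n + 1) t
    have h1 : P.real (endsVacant (n + 1) s t)ᶜ =
        P.real {T | T s ≤ t ∧ T ∈ endsVacant n (s + 1) (T s)} +
        P.real {T | T (s + n + 1) ≤ t ∧ T ∈ endsVacant n s (T (s + n + 1))} := by
      rw [← measureReal_union₀ hB.nullMeasurableSet]
      · refine measureReal_congr ?_
        filter_upwards [ae_regular] with T hT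
        exact propext (hT.notMem_endsVacant_succ_iff n s t)
      · refine measure_mono_null (fun T hT => ?_) ae_regular
        intro hreg
        exact hreg.endsVacant_disjoint n s t hT
    rw [probReal_compl_eq_one_sub (measurableSet_section (measurableSet_endsVacant _ _) t),
      real_arrival (measurableSet_endsVacant n (s + 1)),
      real_arrival (measurableSet_endsVacant n s)] at h1
    · simp_rw [ih] at h1
      rw [setIntegral_Iic_of_hasDerivAt (F := fun x => -(endsVacantProb (n + 1) x / 2))
        (f := endsVacantProb n)
        (fun x => ((hasDerivAt_endsVacantProb_succ n x).div_const 2).neg.congr_deriv (by ring))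
        (by fun_prop), endsVacantProb_zero] at h1
      linarith
    · exact fun u T T' h => endsVacant_congr fun i _ _ => h i (by omega)
    · exact fun u T T' h => endsVacant_congr fun i _ _ => h i (by omega)

/-- The probability that at time `x`, in the process on a half-line, the end site is vacant and
the `n`-th site after it is occupied. -/
noncomputable def endVacantOccupiedProb (n : ℕ) (x : ℝ) : ℝ :=
  -(1 / 2) * Real.exp (-x) * (expSum (n + 1) (-2 * x) - 1)

@[fun_prop]
lemma continuous_endVacantOccupiedProb (n : ℕ) : Continuous (endVacantOccupiedProb n) := by
  unfold endVacantOccupiedProb; fun_prop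

lemma hasDerivAt_endVacantOccupiedProb_succ (n : ℕ) (x : ℝ) :
    HasDerivAt (endVacantOccupiedProb (n + 1))
      (endsVacantProb n x * Real.exp (-x) - endVacantOccupiedProb n x) x := by
  have h := (((hasDerivAt_neg x).exp.const_mul (-(1 / 2))).mul
    ((hasDerivAt_expSum_succ_mul (n + 1) (-2) x).sub_const 1))
  refine h.congr_deriv ?_
  unfold endsVacantProb endVacantOccupiedProb
  ring

lemma real_endVacantOccupied (n : ℕ) (s : ℤ) (t : unitInterval) :
    P.real (endVacantOccupied n s t) = endVacantOccupiedProb n t := by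
  induction n generalizing s t with
  | zero =>
    have h : endVacantOccupied 0 s t = ∅ := by
      ext T
      simp only [endVacantOccupied, endVacant, Set.mem_ofPred_eq, Nat.cast_zero, add_zero,
        Set.mem_empty_iff_false, iff_false]
      tauto
    simp [h, endVacantOccupiedProb, expSum_one]
  | succ n ih =>
    have hE : MeasurableSet {p : unitInterval × (ℤ → unitInterval) |
        p.2 ∈ endsVacant n s p.1 ∩ endVacant 1 (s + n + 2) p.1} :=
      (measurableSet_endsVacant n s).inter (measurableSet_endVacant 1 (s + n + 2))
    have hB := measurableSet_arrival (measurableSet_endVacantOccupied n (s + 1)) s t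
    have h1 : P.real (endVacantOccupied (n + 1) s t) =
        P.real {T | T (s + n + 1) ≤ t ∧
          T ∈ endsVacant n s (T (s + n + 1)) ∩ endVacant 1 (s + n + 2) (T (s + n + 1))} -
        P.real {T | T s ≤ t ∧ T ∈ endVacantOccupied n (s + 1) (T s)} := by
      rw [eq_sub_iff_add_eq, ← measureReal_union₀ hB.nullMeasurableSet]
      · refine measureReal_congr ?_
        filter_upwards [ae_regular] with T hT
        have h2 := hT.mem_endVacantOccupied_succ_iff n s t
        have h3 := hT.of_mem_endVacantOccupied n s t
        refine propext ?_
        change (T ∈ endVacantOccupied (n + 1) s t ∨ _) ↔ _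
        rw [h2]
        exact ⟨fun h => h.elim And.left h3, fun h => or_iff_not_imp_right.2 fun h' => ⟨h, h'⟩⟩
      · refine measure_mono_null (fun T hT => ?_) ae_regular
        intro hreg
        exact ((hreg.mem_endVacantOccupied_succ_iff n s t).1 hT.1).2 hT.2
    have h2 (u : unitInterval) : P.real (endsVacant n s u ∩ endVacant 1 (s + n + 2) u) =
        endsVacantProb n u * Real.exp (-u) := by
      -- With `s + n + 1` not yet arrived, the sites to its left and to its right evolve
      -- independently.
      rw [real_inter_of_dependsOn (Set.Iic (s + n))
        (measurableSet_section (measurableSet_endsVacant n s) u)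
        (measurableSet_section (measurableSet_endVacant 1 (s + n + 2)) u)
        (fun T T' h => endsVacant_congr fun i _ hi => h i hi)
        (fun T T' h => endVacant_congr fun i => h _ (by simp only [Set.mem_Iic]; omega)),
        real_endsVacant, real_endVacant (.inl rfl)]
    rw [h1, real_arrival (E := fun u => endsVacant n s u ∩ endVacant 1 (s + n + 2) u) hE, real_arrival (measurableSet_endVacantOccupied n (s + 1))]
    · simp_rw [h2, ih]
      have hc {f : ℝ → ℝ} (hf : Continuous f) : Integrable (fun u : unitInterval => f u)
          (volume.restrict (Set.Iic t)) :=
        ((hf.comp continuous_subtype_val).integrable_of_hasCompactSupport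
          (.of_compactSpace _)).restrict
      rw [← integral_sub (hc (f := fun u => endsVacantProb n u * Real.exp (-u)) (by fun_prop))
        (hc (by fun_prop)),
        setIntegral_Iic_of_hasDerivAt (hasDerivAt_endVacantOccupiedProb_succ n) (by fun_prop)]
      simp [endVacantOccupiedProb, expSum_succ_zero]
    · exact fun u T T' h => endVacantOccupied_congr fun i _ => h i (by omega)
    · exact fun u T T' h => and_congr (endsVacant_congr fun i _ _ => h i (by omega))
        (endVacant_congr fun i => h _ (by omega))

end Probabilities

/-! ### Assembling the two half-lines -/

lemma ae_eq_D (n : ℕ) (t : unitInterval) :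
    (endVacant (-1) (-1) t ∩ endVacantOccupied n 0 t : Set (ℤ → unitInterval)) =ᵐ[P] D n t := by
  filter_upwards [ae_regular] with T hT
  exact propext (hT.mem_D_iff n t).symm

lemma nullMeasurableSet_D (n : ℕ) (t : unitInterval) : NullMeasurableSet (D n t) P :=
  ((measurableSet_section (measurableSet_endVacant (-1) (-1)) t).inter
    (measurableSet_section (measurableSet_endVacantOccupied n 0) t)).nullMeasurableSet.congr
    (ae_eq_D n t)

lemma gamma_eq (n : ℕ) (t : unitInterval) :
    gamma n t = Real.exp (-t) * endVacantOccupiedProb n t := by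
  rw [gamma, ← measureReal_congr (ae_eq_D n t), real_inter_of_dependsOn (Set.Iic (-1))
    (measurableSet_section (measurableSet_endVacant (-1) (-1)) t)
    (measurableSet_section (measurableSet_endVacantOccupied n 0) t)
    (fun T T' h => endVacant_congr fun i => h _ (by simp only [Set.mem_Iic]; omega))
    (fun T T' h => endVacantOccupied_congr fun i hi => h i (by simp only [Set.mem_Iic]; omega)),
    real_endVacant (.inr rfl), real_endVacantOccupied]

end RSA

theorem proposition1 :
    (∀ᵐ T ∂(RSA.P), ∃! ω : RSA.Evolution, RSA.IsEvolution T ω) ∧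
    ∀ (t : unitInterval) (s : ℕ), Even s →
      NullMeasurableSet (RSA.D (s : ℤ) t) RSA.P ∧
      RSA.gamma (s : ℤ) t =
        -(1 / 2 : ℝ) * Real.exp (-2 * (t : ℝ)) *
          ∑ i ∈ Finset.Icc 1 s, (-2 * (t : ℝ)) ^ i / (Nat.factorial i : ℝ) := by
  refine ⟨RSA.ae_regular.mono fun T hT => hT.existsUnique,
    fun t s _ => ⟨RSA.nullMeasurableSet_D s t, ?_⟩⟩
  -- Subtracting `1` removes the term `i = 0`.
  have h : RSA.expSum (s + 1) (-2 * t) - 1 =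
      ∑ i ∈ Finset.Icc 1 s, (-2 * (t : ℝ)) ^ i / (Nat.factorial i : ℝ) := by
    rw [RSA.expSum, Finset.sum_range_eq_add_Ico _ s.succ_pos, ← Finset.Ico_add_one_right_eq_Icc]
    simp
  have h2 : Real.exp (-2 * (t : ℝ)) = Real.exp (-t) * Real.exp (-t) := by
    rw [← Real.exp_add]; ring_nf
  rw [RSA.gamma_eq, RSA.endVacantOccupiedProb, h, h2]
  ring
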